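/- Let $N,M\ge 0$ be integers, $n=p_1+\dots+p_N$ and $m=m_1+\dots+m_N$, and write $x=(x_1,\dots,x_N)\in\mathbb R^n$ with blocks $x_i\in\mathbb R^{p_i}$. Let $\mathcal C$ be the set of decentralized decision functions $\mu:\mathbb R^n\to\mathbb R^m$, $\mu(x)=(\mu_1(x_1),\dots,\mu_N(x_N))$, with each $\mu_i:\mathbb R^{p_i}\to\mathbb R^{m_i}$ (Borel) measurable, and let $\mathbb K=\{\mathrm{diag}(K_1,\dots,K_N): K_i\in\mathbb R^{m_i\times p_i}\}\subset\mathbb R^{m\times n}$. Let $X\in\mathbb R^{n\times n}$ be symmetric positive semidefinite and let $x\sim\mathcal N(0,X)$ be a Gaussian random vector in $\mathbb R^n$ with mean zero and covariance matrix $X$. For $j=0,\dots,M$ let $\begin{bmatrix}Q_j&S_j\\S_j^{\top}&R_j\end{bmatrix}$ be a real symmetric $(n+m)\times(n+m)$ matrix, with $Q_j\in\mathbb R^{n\times n}$ and $R_j\in\mathbb R^{m\times m}$. Assume that $\begin{bmatrix}Q_0&S_0\\S_0^{\top}&R_0\end{bmatrix}\succeq 0$, that $R_0\succ0$, and that $R_j\succeq0$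 for $j=1,\dots,M$. Let $\gamma_1,\dots,\gamma_M\in\mathbb R$, and consider the problem $$\min_{\mu\in\mathcal C}\ \mathbf E\begin{bmatrix}x\\\mu(x)\end{bmatrix}^{\top}\begin{bmatrix}Q_0&S_0\\S_0^{\top}&R_0\end{bmatrix}\begin{bmatrix}x\\\mu(x)\end{bmatrix}\quad\text{subject to}\quad\mathbf E\begin{bmatrix}x\\\mu(x)\end{bmatrix}^{\top}\begin{bmatrix}Q_j&S_j\\S_j^{\top}&R_j\end{bmatrix}\begin{bmatrix}x\\\mu(x)\end{bmatrix}\le\gamma_j,\quad j=1,\dots,M,$$ where $\mu\in\mathcal C$ is called feasible if the expectations in the objective and in the constraints exist and are finite and the $M$ constraints hold. If the problem is feasible (that is, a feasible $\mu\in\mathcal C$ exists), then a linear decentralized decision is optimal: there is a matrix $K=K(X)\in\mathbb K$, depending only on $X$ and on the problem data $(Q_j,S_j,R_j,\gamma_j)$ and not on the particular random vector $x$, such that $\mu(x)=Kx$ is feasible and attains the minimum of the objective over all feasible $\mu\in\mathcal C$. -/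

import Mathlib

open MeasureTheory ProbabilityTheory Matrix

/-- Coordinates of a vector of `ℝ^(d₁ + ⋯ + d_N)` that is partitioned into `N` blocks of
sizes `d₁, …, d_N`: the pair `⟨i, k⟩` is the `k`-th coordinate of the `i`-th block. -/
abbrev BlockIdx {N : ℕ} (d : Fin N → ℕ) : Type := Σ i : Fin N, Fin (d i)

/-- The class `𝒞` of (measurable) decentralized decision functions: the `i`-th block of `μ x` is
a measurable function `μᵢ : ℝ^{pᵢ} → ℝ^{mᵢ}` of the `i`-th block of `x` alone. -/
def IsDecentralized {N : ℕ} {p m : Fin N → ℕ}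
    (μ : (BlockIdx p → ℝ) → (BlockIdx m → ℝ)) : Prop :=
  ∃ μb : (i : Fin N) → (Fin (p i) → ℝ) → (Fin (m i) → ℝ),
    (∀ i, Measurable (μb i)) ∧
      ∀ (x : BlockIdx p → ℝ) (i : Fin N) (k : Fin (m i)),
        μ x ⟨i, k⟩ = μb i (fun l => x ⟨i, l⟩) k

/-- The set `𝕂` of block diagonal matrices `diag(K₁, …, K_N)` with `Kᵢ ∈ ℝ^{mᵢ × pᵢ}`. -/
def blockDiagonalGains {N : ℕ} (p m : Fin N → ℕ) :
    Set (Matrix (BlockIdx m) (BlockIdx p) ℝ) :=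
  {K | ∃ Kb : (i : Fin N) → Matrix (Fin (m i)) (Fin (p i)) ℝ, K = Matrix.blockDiagonal' Kb}

/-- The quadratic form `[x; u]* [Q, S; S*, R] [x; u]`. -/
def quadForm {ι κ : Type*} [Fintype ι] [Fintype κ] (Q : Matrix ι ι ℝ) (S : Matrix ι κ ℝ)
    (R : Matrix κ κ ℝ) (x : ι → ℝ) (u : κ → ℝ) : ℝ :=
  Sum.elim x u ⬝ᵥ (Matrix.fromBlocks Q S Sᵀ R *ᵥ Sum.elim x u)

section TeamProblem

variable {Ω : Type*} [MeasurableSpace Ω] {N M : ℕ} {p m : Fin N → ℕ}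

/-- The integrand `[x; μ(x)]* [Q, S; S*, R] [x; μ(x)]`, as a random variable. -/
def decisionForm (x : Ω → EuclideanSpace ℝ (BlockIdx p))
    (Q : Matrix (BlockIdx p) (BlockIdx p) ℝ) (S : Matrix (BlockIdx p) (BlockIdx m) ℝ)
    (R : Matrix (BlockIdx m) (BlockIdx m) ℝ)
    (μ : (BlockIdx p → ℝ) → (BlockIdx m → ℝ)) (ω : Ω) : ℝ :=
  quadForm Q S R (x ω).ofLp (μ (x ω).ofLp)

/-- `μ` is feasible for the team problem with state `x`: it is decentralized, the expectations in
the problem exist (and are finite), and the constraints hold. Index `0` is the objective, and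
index `j + 1` belongs to the constraint with bound `γ j`. -/
structure IsFeasible (P : Measure Ω) (x : Ω → EuclideanSpace ℝ (BlockIdx p))
    (Q : Fin (M + 1) → Matrix (BlockIdx p) (BlockIdx p) ℝ)
    (S : Fin (M + 1) → Matrix (BlockIdx p) (BlockIdx m) ℝ)
    (R : Fin (M + 1) → Matrix (BlockIdx m) (BlockIdx m) ℝ)
    (γ : Fin M → ℝ) (μ : (BlockIdx p → ℝ) → (BlockIdx m → ℝ)) : Prop where
  decentralized : IsDecentralized μ
  integrable : ∀ j : Fin (M + 1), Integrable (decisionForm x (Q j) (S j) (R j) μ) P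
  constraint : ∀ j : Fin M,
    ∫ ω, decisionForm x (Q j.succ) (S j.succ) (R j.succ) μ ω ∂P ≤ γ j

/-- `μ` is optimal: it is feasible, and no feasible decision has a smaller expected cost. -/
def IsOptimal (P : Measure Ω) (x : Ω → EuclideanSpace ℝ (BlockIdx p))
    (Q : Fin (M + 1) → Matrix (BlockIdx p) (BlockIdx p) ℝ)
    (S : Fin (M + 1) → Matrix (BlockIdx p) (BlockIdx m) ℝ)
    (R : Fin (M + 1) → Matrix (BlockIdx m) (BlockIdx m) ℝ)
    (γ : Fin M → ℝ) (μ : (BlockIdx p → ℝ) → (BlockIdx m → ℝ)) : Prop :=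
  IsFeasible P x Q S R γ μ ∧
    ∀ ν : (BlockIdx p → ℝ) → (BlockIdx m → ℝ), IsFeasible P x Q S R γ ν →
      ∫ ω, decisionForm x (Q 0) (S 0) (R 0) μ ω ∂P
        ≤ ∫ ω, decisionForm x (Q 0) (S 0) (R 0) ν ω ∂P

end TeamProblem

/-!
A feasible decision `μ` has finite expected objective, and the objective is coercive in the
decision because `R 0` is positive definite, so `μ(x)` is square integrable
(`memLp_two_of_integrable_decisionForm`). Let `Kᵢ xᵢ` be the `L²` regression of `μᵢ(xᵢ)` on the
coordinates of `xᵢ`, and `eᵢ` its residual. Then `eᵢ` is a function of `xᵢ` that is orthogonal to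
`xᵢ`. Since `x` is Gaussian, every coordinate of `x` is a linear function of `xᵢ` plus a centred
variable independent of `xᵢ`, so `eᵢ` is orthogonal to the whole of `x`
(`integral_mul_eq_zero_of_hasGaussianLaw`). Hence, for each of the quadratic forms, replacing
`μ(x) = K x + e` by `K x` changes the expected value exactly by `-E eᵀ R e ≤ 0`: the linear
decision `K x` is at least as good as `μ` in the objective and in all constraints at once
(`exists_linear_dominating`).

It remains to minimise over linear decisions. If the covariance is `X = B Bᵀ`, the expected value
of each form at `K x` is a continuous function of `Y = K B` (`integral_quadForm_linear`). These `Y`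
form a linear subspace, on which the objective is coercive even if `X` is singular, so a minimiser
exists by compactness (`exists_minimizer_columnCost`). That finite-dimensional problem involves
only `X` and the data of the problem, and hence so does the gain.
-/

/-! ### Quadratic forms -/

section QuadraticForms

variable {ι κ : Type*} [Fintype ι] [Fintype κ]

lemma quadForm_eq (Q : Matrix ι ι ℝ) (S : Matrix ι κ ℝ) (R : Matrix κ κ ℝ) (x : ι → ℝ)
    (u : κ → ℝ) :
    quadForm Q S R x u
      = x ⬝ᵥ (Q *ᵥ x) + x ⬝ᵥ (S *ᵥ u) + u ⬝ᵥ (Sᵀ *ᵥ x) + u ⬝ᵥ (R *ᵥ u) := by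
  rw [quadForm, Matrix.fromBlocks_mulVec, sumElim_dotProduct_sumElim]
  simp only [Function.comp_def, Sum.elim_inl, Sum.elim_inr, dotProduct_add]
  ring

lemma dotProduct_mulVec_eq_sum (T : Matrix ι κ ℝ) (x : ι → ℝ) (u : κ → ℝ) :
    x ⬝ᵥ (T *ᵥ u) = ∑ a, ∑ b, T a b * (x a * u b) := by
  simp only [dotProduct, mulVec, Finset.mul_sum]
  exact Finset.sum_congr rfl fun a _ ↦ Finset.sum_congr rfl fun b _ ↦ by ring

/-- For a linear decision the form is a quadratic form in the state alone. -/
lemma quadForm_linear_eq_sum (Q : Matrix ι ι ℝ) (S : Matrix ι κ ℝ) (R : Matrix κ κ ℝ)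
    (K : Matrix κ ι ℝ) (x : ι → ℝ) :
    quadForm Q S R x (K *ᵥ x)
      = ∑ a, ∑ b, (Q + S * K + Kᵀ * Sᵀ + Kᵀ * R * K) a b * (x a * x b) := by
  rw [← dotProduct_mulVec_eq_sum, quadForm_eq]
  simp only [add_mulVec, dotProduct_add, ← mulVec_mulVec, dotProduct_mulVec _ Kᵀ,
    vecMul_transpose]

lemma quadForm_linear_add (Q : Matrix ι ι ℝ) (S : Matrix ι κ ℝ) (R : Matrix κ κ ℝ)
    (K : Matrix κ ι ℝ) (x : ι → ℝ) (e : κ → ℝ) :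
    quadForm Q S R x (K *ᵥ x + e)
      = quadForm Q S R x (K *ᵥ x)
        + ∑ a, ∑ b, (S + S + Kᵀ * R + Kᵀ * Rᵀ) a b * (x a * e b) + e ⬝ᵥ (R *ᵥ e) := by
  rw [← dotProduct_mulVec_eq_sum, quadForm_eq, quadForm_eq]
  have h₁ : e ⬝ᵥ (Sᵀ *ᵥ x) = x ⬝ᵥ (S *ᵥ e) := by
    rw [dotProduct_comm, mulVec_transpose, ← dotProduct_mulVec]
  have h₂ : e ⬝ᵥ (R *ᵥ (K *ᵥ x)) = x ⬝ᵥ ((Kᵀ * Rᵀ) *ᵥ e) := by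
    rw [dotProduct_comm, mulVec_mulVec, ← transpose_mul, mulVec_transpose, dotProduct_comm,
      dotProduct_mulVec, dotProduct_comm]
  have h₃ : (K *ᵥ x) ⬝ᵥ (R *ᵥ e) = x ⬝ᵥ ((Kᵀ * R) *ᵥ e) := by
    rw [← mulVec_mulVec, dotProduct_mulVec _ Kᵀ, vecMul_transpose]
  simp only [add_mulVec, mulVec_add, dotProduct_add, add_dotProduct, h₁, h₂, h₃]
  ring

/-- A positive definite form controls each coordinate, by compactness of the unit sphere. -/
lemma Matrix.PosDef.exists_sq_le {R : Matrix κ κ ℝ} (hR : R.PosDef) :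
    ∃ C : ℝ, 0 ≤ C ∧ ∀ (u : κ → ℝ) (b : κ), u b ^ 2 ≤ C * (u ⬝ᵥ (R *ᵥ u)) := by
  have hcont : Continuous fun u : κ → ℝ ↦ u ⬝ᵥ (R *ᵥ u) := by
    fun_prop
  have hpos : ∀ u : κ → ℝ, u ≠ 0 → 0 < u ⬝ᵥ (R *ᵥ u) := fun u hu ↦ by
    simpa using hR.dotProduct_mulVec_pos hu
  rcases isEmpty_or_nonempty κ with h | h
  · exact ⟨0, le_rfl, fun u b ↦ isEmptyElim b⟩
  obtain ⟨v, hv, hmin⟩ := (isCompact_sphere (0 : κ → ℝ) 1).exists_isMinOn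
    (NormedSpace.sphere_nonempty.2 zero_le_one) hcont.continuousOn
  have hv0 : v ≠ 0 := by
    rintro rfl
    simp at hv
  have hc := hpos v hv0
  refine ⟨(v ⬝ᵥ (R *ᵥ v))⁻¹, by positivity, fun u b ↦ ?_⟩
  rw [inv_mul_eq_div, le_div_iff₀ hc]
  rcases eq_or_ne u 0 with rfl | hu
  · simp
  have hn : 0 < ‖u‖ := norm_pos_iff.2 hu
  have h₁ : v ⬝ᵥ (R *ᵥ v) ≤ (‖u‖⁻¹ • u) ⬝ᵥ (R *ᵥ (‖u‖⁻¹ • u)) :=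
    hmin (by simp [norm_smul, hn.ne'])
  have h₂ : v ⬝ᵥ (R *ᵥ v) * ‖u‖ ^ 2 ≤ u ⬝ᵥ (R *ᵥ u) := by
    rw [mulVec_smul, smul_dotProduct, dotProduct_smul, smul_eq_mul, smul_eq_mul] at h₁
    calc _ ≤ (‖u‖⁻¹ * (‖u‖⁻¹ * u ⬝ᵥ (R *ᵥ u))) * ‖u‖ ^ 2 := by gcongr
      _ = u ⬝ᵥ (R *ᵥ u) := by field_simp
  have h₃ : u b ^ 2 ≤ ‖u‖ ^ 2 := by
    rw [← sq_abs]
    gcongr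
    exact norm_le_pi_norm u b
  calc u b ^ 2 * v ⬝ᵥ (R *ᵥ v) ≤ ‖u‖ ^ 2 * v ⬝ᵥ (R *ᵥ v) := by gcongr
    _ ≤ _ := by rwa [mul_comm]

/-- The objective is coercive in the decision. Since the full form is only positive semidefinite,
the decision is split off as `(0, u) = (x, u) - (x, 0)`, where the parallelogram law bounds the
form. -/
lemma exists_sq_le_quadForm {Q : Matrix ι ι ℝ} {S : Matrix ι κ ℝ} {R : Matrix κ κ ℝ}
    (hQ : (Matrix.fromBlocks Q S Sᵀ R).PosSemidef) (hR : R.PosDef) :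
    ∃ C : ℝ, 0 ≤ C ∧ ∀ (x : ι → ℝ) (u : κ → ℝ) (b : κ),
      u b ^ 2 ≤ C * (quadForm Q S R x u + x ⬝ᵥ (Q *ᵥ x)) := by
  obtain ⟨C, hC, h⟩ := hR.exists_sq_le
  refine ⟨2 * C, by positivity, fun x u b ↦ (h u b).trans ?_⟩
  -- The term to discard in the parallelogram law: the form at `(2 x, u) = (x, u) + (x, 0)`.
  have h₁ : 0 ≤ quadForm Q S R ((2 : ℝ) • x) u := by
    have := hQ.dotProduct_mulVec_nonneg (Sum.elim ((2 : ℝ) • x) u)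
    rwa [star_trivial] at this
  rw [quadForm_eq] at h₁ ⊢
  simp only [smul_dotProduct, mulVec_smul, dotProduct_smul, smul_eq_mul] at h₁
  nlinarith

end QuadraticForms

/-! ### Expected cost of linear decisions and existence of a minimiser -/

section LinearDecisions

variable {ι κ θ : Type*} [Fintype ι] [Fintype κ] [Fintype θ]

/-- The sum of a quadratic form over the columns of `B` and `Y`. If `X = B Bᵀ` is the covariance
of the state, then it is the expected value of the form for the decision `x ↦ K x` at
`Y = K B`. -/
def columnCost (Q : Matrix ι ι ℝ) (S : Matrix ι κ ℝ) (R : Matrix κ κ ℝ) (B : Matrix ι θ ℝ)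
    (Y : Matrix κ θ ℝ) : ℝ :=
  ∑ k, quadForm Q S R (fun a ↦ B a k) (fun b ↦ Y b k)

lemma continuous_columnCost (Q : Matrix ι ι ℝ) (S : Matrix ι κ ℝ) (R : Matrix κ κ ℝ)
    (B : Matrix ι θ ℝ) : Continuous (columnCost Q S R B) := by
  unfold columnCost
  simp only [quadForm_eq, dotProduct, mulVec]
  fun_prop

lemma columnCost_mul (Q : Matrix ι ι ℝ) (S : Matrix ι κ ℝ) (R : Matrix κ κ ℝ)
    (B : Matrix ι θ ℝ) (K : Matrix κ ι ℝ) :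
    columnCost Q S R B (K * B)
      = ∑ a, ∑ b, (Q + S * K + Kᵀ * Sᵀ + Kᵀ * R * K) a b * (B * Bᵀ) a b := by
  have h : ∀ k, (fun b ↦ (K * B) b k) = K *ᵥ fun a ↦ B a k := fun k ↦ rfl
  simp only [columnCost, h, quadForm_linear_eq_sum]
  rw [Finset.sum_comm]
  refine Finset.sum_congr rfl fun a _ ↦ ?_
  rw [Finset.sum_comm]
  refine Finset.sum_congr rfl fun b _ ↦ ?_
  rw [← Finset.mul_sum]
  simp [Matrix.mul_apply]

/-- Existence of a minimiser: the linear decisions enter only through the points `Y = K B` of a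
finite-dimensional, hence closed, space, on which the objective is coercive. -/
lemma exists_minimizer_columnCost {M : ℕ} {Q : Fin (M + 1) → Matrix ι ι ℝ}
    {S : Fin (M + 1) → Matrix ι κ ℝ} {R : Fin (M + 1) → Matrix κ κ ℝ} (γ : Fin M → ℝ)
    (hQ₀ : (Matrix.fromBlocks (Q 0) (S 0) (S 0)ᵀ (R 0)).PosSemidef) (hR₀ : (R 0).PosDef)
    (B : Matrix ι θ ℝ) (W : Submodule ℝ (Matrix κ θ ℝ))
    (hne : ∃ Y ∈ W, ∀ j : Fin M, columnCost (Q j.succ) (S j.succ) (R j.succ) B Y ≤ γ j) :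
    ∃ Y ∈ W, (∀ j : Fin M, columnCost (Q j.succ) (S j.succ) (R j.succ) B Y ≤ γ j) ∧
      ∀ Z ∈ W, (∀ j : Fin M, columnCost (Q j.succ) (S j.succ) (R j.succ) B Z ≤ γ j) →
        columnCost (Q 0) (S 0) (R 0) B Y ≤ columnCost (Q 0) (S 0) (R 0) B Z := by
  obtain ⟨Y₀, hY₀, hY₀γ⟩ := hne
  obtain ⟨C, hC, hbound⟩ := exists_sq_le_quadForm hQ₀ hR₀
  set f := columnCost (Q 0) (S 0) (R 0) B
  let D : Set (Matrix κ θ ℝ) :=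
    {Y | Y ∈ W ∧ (∀ j : Fin M, columnCost (Q j.succ) (S j.succ) (R j.succ) B Y ≤ γ j) ∧
      f Y ≤ f Y₀}
  have hclosed : IsClosed D := by
    refine (Submodule.closed_of_finiteDimensional W).inter (IsClosed.inter ?_ ?_)
    · have : IsClosed (⋂ j : Fin M,
          {Y | columnCost (Q j.succ) (S j.succ) (R j.succ) B Y ≤ γ j}) :=
        isClosed_iInter fun j ↦ isClosed_le (continuous_columnCost _ _ _ _) continuous_const
      exact (congrArg IsClosed (Set.ofPred_forall _)).mpr this
    · exact isClosed_le (continuous_columnCost _ _ _ _) continuous_const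
  have hnonneg : ∀ x u, 0 ≤ quadForm (Q 0) (S 0) (R 0) x u := fun x u ↦ by
    have := hQ₀.dotProduct_mulVec_nonneg (Sum.elim x u)
    rwa [star_trivial] at this
  -- By coercivity in each column, all entries of a point of `D` are bounded by `r`.
  let T : ℝ := ∑ k, |(fun a ↦ B a k) ⬝ᵥ (Q 0 *ᵥ fun a ↦ B a k)|
  let r : ℝ := Real.sqrt (C * (f Y₀ + T))
  have hcompact : IsCompact {Y : Matrix κ θ ℝ | ∀ b k, Y b k ∈ Set.Icc (-r) r} := by
    have := isCompact_univ_pi fun _ : κ ↦ isCompact_univ_pi fun _ : θ ↦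
      isCompact_Icc (a := -r) (b := r)
    refine (congrArg IsCompact ?_).mp this
    ext Y
    simp only [Set.mem_pi, Set.mem_univ, forall_const]
    rfl
  have hsub : D ⊆ {Y | ∀ b k, Y b k ∈ Set.Icc (-r) r} := by
    rintro Y ⟨-, -, hY⟩ b k
    refine abs_le.1 (Real.le_sqrt_of_sq_le ?_)
    rw [sq_abs]
    refine (hbound (fun a ↦ B a k) (fun b ↦ Y b k) b).trans ?_
    gcongr
    · refine le_trans ?_ hY
      exact Finset.single_le_sum
        (f := fun k ↦ quadForm (Q 0) (S 0) (R 0) (fun a ↦ B a k) (fun b ↦ Y b k))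
        (fun _ _ ↦ hnonneg _ _) (Finset.mem_univ k)
    · exact (le_abs_self _).trans (Finset.single_le_sum
        (f := fun k ↦ |(fun a ↦ B a k) ⬝ᵥ (Q 0 *ᵥ fun a ↦ B a k)|)
        (fun _ _ ↦ abs_nonneg _) (Finset.mem_univ k))
  obtain ⟨Y, ⟨hYW, hYγ, hYf⟩, hmin⟩ := (hcompact.of_isClosed_subset hclosed hsub).exists_isMinOn
    ⟨Y₀, hY₀, hY₀γ, le_rfl⟩ (continuous_columnCost (Q 0) (S 0) (R 0) B).continuousOn
  refine ⟨Y, hYW, hYγ, fun Z hZW hZγ ↦ ?_⟩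
  by_cases hZ : f Z ≤ f Y₀
  · exact hmin ⟨hZW, hZγ, hZ⟩
  · exact hYf.trans (not_le.1 hZ).le

end LinearDecisions

/-! ### Regression and orthogonality in `L²` -/

section Probability

variable {Ω : Type*} [MeasurableSpace Ω] {P : Measure Ω}

lemma integrable_sum_mul {ι κ : Type*} [Fintype ι] [Fintype κ] {x : ι → Ω → ℝ} {y : κ → Ω → ℝ}
    (hx : ∀ a, MemLp (x a) 2 P) (hy : ∀ b, MemLp (y b) 2 P) (T : Matrix ι κ ℝ) :
    Integrable (fun ω ↦ ∑ a, ∑ b, T a b * (x a ω * y b ω)) P :=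
  integrable_finsetSum _ fun a _ ↦ integrable_finsetSum _ fun b _ ↦
    ((hx a).integrable_mul (hy b)).const_mul _

lemma integral_sum_mul {ι κ : Type*} [Fintype ι] [Fintype κ] {x : ι → Ω → ℝ} {y : κ → Ω → ℝ}
    (hx : ∀ a, MemLp (x a) 2 P) (hy : ∀ b, MemLp (y b) 2 P) (T : Matrix ι κ ℝ) :
    ∫ ω, ∑ a, ∑ b, T a b * (x a ω * y b ω) ∂P = ∑ a, ∑ b, T a b * ∫ ω, x a ω * y b ω ∂P := by
  have h : ∀ a b, Integrable (fun ω ↦ T a b * (x a ω * y b ω)) P := fun a b ↦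
    ((hx a).integrable_mul (hy b)).const_mul _
  rw [integral_finsetSum _ fun a _ ↦ integrable_finsetSum _ fun b _ ↦ h a b]
  refine Finset.sum_congr rfl fun a _ ↦ ?_
  rw [integral_finsetSum _ fun b _ ↦ h a b]
  exact Finset.sum_congr rfl fun b _ ↦ integral_const_mul _ _

/-- Solvability of the normal equations, also for linearly dependent regressors: the coefficients
are those of the orthogonal projection in `L²` onto the span of the `f k`. -/
lemma exists_linear_regression {κ : Type*} [Fintype κ] {f : κ → Ω → ℝ}
    (hf : ∀ k, MemLp (f k) 2 P) {h : Ω → ℝ} (hh : MemLp h 2 P) :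
    ∃ c : κ → ℝ, ∀ k, ∫ ω, f k ω * (h ω - ∑ l, c l * f l ω) ∂P = 0 := by
  let F : κ → Lp ℝ 2 P := fun k ↦ (hf k).toLp
  let V : Submodule ℝ (Lp ℝ 2 P) := Submodule.span ℝ (Set.range F)
  have : FiniteDimensional ℝ V := FiniteDimensional.span_of_finite ℝ (Set.finite_range F)
  obtain ⟨c, hc⟩ := (Submodule.mem_span_range_iff_exists_fun ℝ).1
    (V.orthogonalProjectionOnto (hh.toLp)).2
  refine ⟨c, fun k ↦ ?_⟩
  have h₁ : inner ℝ (F k) (hh.toLp - ∑ l, c l • F l) = 0 := by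
    rw [hc]
    exact Submodule.sub_starProjection_mem_orthogonal (K := V) (hh.toLp) (F k)
      (Submodule.subset_span ⟨k, rfl⟩)
  rw [L2.inner_def] at h₁
  rw [← h₁]
  refine integral_congr_ae ?_
  have h₂ : ((hh.toLp - ∑ l, c l • F l : Lp ℝ 2 P) : Ω → ℝ)
      =ᵐ[P] fun ω ↦ h ω - ∑ l, c l * f l ω := by
    have h₃ : ∀ᵐ ω ∂P, ∀ l, (c l • F l : Lp ℝ 2 P) ω = c l * f l ω := by
      refine ae_all_iff.2 fun l ↦ ?_
      filter_upwards [Lp.coeFn_smul (c l) (F l), (hf l).coeFn_toLp] with ω h₄ h₅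
      rw [h₄, Pi.smul_apply, h₅, smul_eq_mul]
    filter_upwards [Lp.coeFn_sub hh.toLp (∑ l, c l • F l), hh.coeFn_toLp,
      Lp.coeFn_fun_finsetSum Finset.univ fun l ↦ c l • F l, h₃] with ω h₄ h₅ h₆ h₇
    rw [h₄, Pi.sub_apply, h₅, h₆]
    simp only [h₇]
  filter_upwards [h₂, (hf k).coeFn_toLp] with ω h₅ h₆
  rw [h₅]
  simp only [F, h₆]
  simp [mul_comm]

/-- The Gaussian input of the argument. If a function of the coordinates `x (s k)` is orthogonal
to all of them, then it is orthogonal to every coordinate of `x`: the residual of `x a` after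
regression on the `x (s k)` is uncorrelated with them, hence independent of them. -/
lemma integral_mul_eq_zero_of_hasGaussianLaw {ι κ : Type*} [Fintype ι] [Fintype κ]
    {x : ι → Ω → ℝ} (hx : HasGaussianLaw (fun ω a ↦ x a ω) P) (hx₀ : ∀ a, ∫ ω, x a ω ∂P = 0)
    (s : κ → ι) {g : (κ → ℝ) → ℝ} (hg : Measurable g)
    (hgL : MemLp (fun ω ↦ g fun k ↦ x (s k) ω) 2 P)
    (horth : ∀ k, ∫ ω, x (s k) ω * g (fun l ↦ x (s l) ω) ∂P = 0) (a : ι) :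
    ∫ ω, x a ω * g (fun l ↦ x (s l) ω) ∂P = 0 := by
  have := hx.isProbabilityMeasure
  have hL : ∀ a, MemLp (x a) 2 P := fun a ↦ (hx.eval a).memLp_two
  obtain ⟨c, hc⟩ := exists_linear_regression (fun k ↦ hL (s k)) (hL a)
  set e : Ω → ℝ := fun ω ↦ g fun l ↦ x (s l) ω with he
  set z : Ω → ℝ := fun ω ↦ x a ω - ∑ l, c l * x (s l) ω with hz
  have hzL : MemLp z 2 P := (hL a).sub (memLp_finsetSum _ fun l _ ↦ (hL (s l)).const_mul _)
  have hz₀ : ∫ ω, z ω ∂P = 0 := by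
    have h₁ : ∀ l, Integrable (fun ω ↦ c l * x (s l) ω) P := fun l ↦
      ((hL (s l)).integrable one_le_two).const_mul _
    rw [hz, integral_sub ((hL a).integrable one_le_two) (integrable_finsetSum _ fun l _ ↦ h₁ l),
      integral_finsetSum _ fun l _ ↦ h₁ l]
    simp [integral_const_mul, hx₀]
  have hgauss : HasGaussianLaw (fun ω ↦ (fun _ : Unit ↦ z ω, fun k ↦ x (s k) ω)) P := by
    let L : (ι → ℝ) →L[ℝ] (Unit → ℝ) × (κ → ℝ) :=
      (ContinuousLinearMap.pi fun _ ↦ ContinuousLinearMap.proj (R := ℝ) (φ := fun _ : ι ↦ ℝ) a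
        - ∑ l, c l • ContinuousLinearMap.proj (R := ℝ) (φ := fun _ : ι ↦ ℝ) (s l)).prod
      (ContinuousLinearMap.pi fun k ↦ ContinuousLinearMap.proj (R := ℝ) (φ := fun _ : ι ↦ ℝ) (s k))
    convert! hx.map_fun L using 1
    ext ω <;> simp [L, hz]
  have hindep : IndepFun (fun ω (_ : Unit) ↦ z ω) (fun ω k ↦ x (s k) ω) P := by
    refine hgauss.indepFun_of_covariance_eval (X := fun _ ↦ z) (Y := fun k ↦ x (s k))
      fun _ k ↦ ?_
    rw [covariance_eq_sub hzL (hL (s k)), hz₀, zero_mul, sub_zero, ← hc k]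
    exact integral_congr_ae (.of_forall fun ω ↦ mul_comm _ _)
  have hze : ∫ ω, z ω * e ω ∂P = 0 := by
    have h₁ : IndepFun z e P := hindep.comp (measurable_pi_apply ()) hg
    rw [h₁.integral_fun_mul_eq_mul_integral hzL.1 hgL.1, hz₀, zero_mul]
  -- The regressed part of `x a` is orthogonal to `e` by hypothesis, the residual `z` by
  -- independence.
  have hsplit : ∀ ω, x a ω * e ω = z ω * e ω + ∑ l, c l * (x (s l) ω * e ω) := fun ω ↦ by
    simp only [hz, sub_mul, Finset.sum_mul, mul_assoc, sub_add_cancel]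
  have h₂ : ∀ l, Integrable (fun ω ↦ c l * (x (s l) ω * e ω)) P := fun l ↦
    ((hL (s l)).integrable_mul hgL).const_mul _
  rw [integral_congr_ae (.of_forall hsplit), integral_add (f := fun ω ↦ z ω * e ω)
    (hzL.integrable_mul hgL) (integrable_finsetSum _ fun l _ ↦ h₂ l), hze,
    integral_finsetSum _ fun l _ ↦ h₂ l]
  simp [integral_const_mul, he, horth]

/-- If the deviation `e` from a linear decision is orthogonal to the state, then only its
nonnegative second-order term changes the expected value of the form. -/
lemma integral_quadForm_linear_le {ι κ : Type*} [Fintype ι] [Fintype κ] {x : ι → Ω → ℝ}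
    {e : κ → Ω → ℝ} (hx : ∀ a, MemLp (x a) 2 P) (he : ∀ b, MemLp (e b) 2 P)
    (horth : ∀ a b, ∫ ω, x a ω * e b ω ∂P = 0)
    (Q : Matrix ι ι ℝ) (S : Matrix ι κ ℝ) {R : Matrix κ κ ℝ} (hR : R.PosSemidef)
    (K : Matrix κ ι ℝ) :
    ∫ ω, quadForm Q S R (fun a ↦ x a ω) (K *ᵥ fun a ↦ x a ω) ∂P
      ≤ ∫ ω, quadForm Q S R (fun a ↦ x a ω) ((K *ᵥ fun a ↦ x a ω) + fun b ↦ e b ω) ∂P := by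
  have h₁ : Integrable (fun ω ↦ quadForm Q S R (fun a ↦ x a ω) (K *ᵥ fun a ↦ x a ω)) P := by
    simp only [quadForm_linear_eq_sum]
    exact integrable_sum_mul hx hx _
  have h₂ := integrable_sum_mul hx he (S + S + Kᵀ * R + Kᵀ * Rᵀ)
  have h₃ : Integrable (fun ω ↦ (fun b ↦ e b ω) ⬝ᵥ (R *ᵥ fun b ↦ e b ω)) P := by
    simp only [dotProduct_mulVec_eq_sum]
    exact integrable_sum_mul he he R
  have h₄ : 0 ≤ ∫ ω, (fun b ↦ e b ω) ⬝ᵥ (R *ᵥ fun b ↦ e b ω) ∂P :=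
    integral_nonneg fun ω ↦ by
      simpa using hR.dotProduct_mulVec_nonneg fun b ↦ e b ω
  simp only [quadForm_linear_add]
  rw [integral_add (f := fun ω ↦ quadForm Q S R (fun a ↦ x a ω) (K *ᵥ fun a ↦ x a ω)
    + ∑ a, ∑ b, (S + S + Kᵀ * R + Kᵀ * Rᵀ) a b * (x a ω * e b ω)) (h₁.add h₂) h₃,
    integral_add h₁ h₂, integral_sum_mul hx he]
  simp only [horth, mul_zero, Finset.sum_const_zero, add_zero]
  exact le_add_of_nonneg_right h₄

end Probability

/-! ### Gaussian states -/

open scoped MatrixOrder in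
lemma Matrix.PosSemidef.exists_mul_transpose_eq {ι : Type*} [Fintype ι] [DecidableEq ι]
    {X : Matrix ι ι ℝ} (hX : X.PosSemidef) : ∃ B : Matrix ι ι ℝ, B * Bᵀ = X := by
  obtain ⟨A, hA⟩ := CStarAlgebra.nonneg_iff_eq_star_mul_self.1 hX.nonneg
  exact ⟨Aᵀ, by rw [hA, transpose_transpose]; rfl⟩

section GaussianState

variable {Ω : Type*} [MeasurableSpace Ω] {P : Measure Ω} {ι : Type*} [Fintype ι] [DecidableEq ι]
  {X : Matrix ι ι ℝ} {x : Ω → EuclideanSpace ℝ ι}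

lemma hasGaussianLaw_coords (hx : HasLaw x (multivariateGaussian 0 X) P) :
    HasGaussianLaw (fun ω a ↦ x ω a) P :=
  hx.hasGaussianLaw.map_equiv_fun (EuclideanSpace.equiv ι ℝ)

lemma integral_coord (hx : HasLaw x (multivariateGaussian 0 X) P) (a : ι) :
    ∫ ω, x ω a ∂P = 0 := by
  rw [← eval_integral_piLp (q := 2) fun a ↦
    ((hasGaussianLaw_coords hx).eval a).integrable, hx.integral_eq,
    integral_id_multivariateGaussian]
  rfl

lemma integral_coord_mul_coord (hX : X.PosSemidef)
    (hx : HasLaw x (multivariateGaussian 0 X) P) (a b : ι) :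
    ∫ ω, x ω a * x ω b ∂P = X a b := by
  have hG := hasGaussianLaw_coords hx
  have := hG.isProbabilityMeasure
  rw [← covariance_eval_multivariateGaussian (μ := 0) hX a b,
    ← hx.covariance_fun_comp (f := fun y ↦ y a) (g := fun y ↦ y b) (by fun_prop) (by fun_prop),
    covariance_eq_sub (hG.eval a).memLp_two (hG.eval b).memLp_two, integral_coord hx,
    zero_mul, sub_zero]
  rfl

lemma integrable_quadForm_linear {κ : Type*} [Fintype κ]
    (hx : HasLaw x (multivariateGaussian 0 X) P) (Q : Matrix ι ι ℝ) (S : Matrix ι κ ℝ)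
    (R : Matrix κ κ ℝ) (K : Matrix κ ι ℝ) :
    Integrable (fun ω ↦ quadForm Q S R (x ω).ofLp (K *ᵥ (x ω).ofLp)) P := by
  have hL := fun a ↦ ((hasGaussianLaw_coords hx).eval a).memLp_two
  simp only [quadForm_linear_eq_sum]
  exact integrable_sum_mul hL hL _

/-- The expected value of the form for a linear decision, in terms of a factor of the
covariance. -/
lemma integral_quadForm_linear {κ θ : Type*} [Fintype κ] [Fintype θ] (hX : X.PosSemidef)
    (hx : HasLaw x (multivariateGaussian 0 X) P) {B : Matrix ι θ ℝ} (hB : B * Bᵀ = X)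
    (Q : Matrix ι ι ℝ) (S : Matrix ι κ ℝ) (R : Matrix κ κ ℝ) (K : Matrix κ ι ℝ) :
    ∫ ω, quadForm Q S R (x ω).ofLp (K *ᵥ (x ω).ofLp) ∂P = columnCost Q S R B (K * B) := by
  have hL := fun a ↦ ((hasGaussianLaw_coords hx).eval a).memLp_two
  simp only [quadForm_linear_eq_sum, columnCost_mul, hB]
  rw [integral_sum_mul hL hL]
  simp only [integral_coord_mul_coord hX hx]

end GaussianState

/-! ### Linear decisions dominate decentralized ones -/

section Domination

variable {Ω : Type*} [MeasurableSpace Ω] {P : Measure Ω} {N M : ℕ} {p m : Fin N → ℕ}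
  {X : Matrix (BlockIdx p) (BlockIdx p) ℝ} {x : Ω → EuclideanSpace ℝ (BlockIdx p)}

lemma IsDecentralized.measurable {μ : (BlockIdx p → ℝ) → (BlockIdx m → ℝ)}
    (hμ : IsDecentralized μ) : Measurable μ := by
  obtain ⟨μb, hμb, hμ⟩ := hμ
  refine measurable_pi_lambda _ fun ⟨i, k⟩ ↦ ?_
  simp only [hμ]
  exact (measurable_pi_apply k).comp ((hμb i).comp
    (measurable_pi_lambda _ fun l ↦ measurable_pi_apply _))

lemma blockDiagonal'_mulVec (Kb : (i : Fin N) → Matrix (Fin (m i)) (Fin (p i)) ℝ)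
    (y : BlockIdx p → ℝ) (i : Fin N) (k : Fin (m i)) :
    (Matrix.blockDiagonal' Kb *ᵥ y) ⟨i, k⟩ = ∑ l, Kb i k l * y ⟨i, l⟩ := by
  rw [mulVec, dotProduct, Fintype.sum_sigma, Finset.sum_eq_single i]
  · simp only [blockDiagonal'_apply_eq]
  · intro j _ hj
    refine Finset.sum_eq_zero fun l _ ↦ ?_
    rw [blockDiagonal'_apply_ne _ _ _ hj.symm, zero_mul]
  · simp

lemma isDecentralized_of_mem_blockDiagonalGains {K : Matrix (BlockIdx m) (BlockIdx p) ℝ}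
    (hK : K ∈ blockDiagonalGains p m) : IsDecentralized fun y ↦ K *ᵥ y := by
  obtain ⟨Kb, rfl⟩ := hK
  refine ⟨fun i y ↦ Kb i *ᵥ y, fun i ↦ ?_, fun y i k ↦ blockDiagonal'_mulVec Kb y i k⟩
  exact (Continuous.matrix_mulVec continuous_const continuous_id).measurable

/-- A decision with finite expected objective is square integrable. -/
lemma memLp_two_of_integrable_decisionForm {Q : Matrix (BlockIdx p) (BlockIdx p) ℝ}
    {S : Matrix (BlockIdx p) (BlockIdx m) ℝ} {R : Matrix (BlockIdx m) (BlockIdx m) ℝ}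
    (hQ : (Matrix.fromBlocks Q S Sᵀ R).PosSemidef) (hR : R.PosDef)
    (hx : HasLaw x (multivariateGaussian 0 X) P) {μ : (BlockIdx p → ℝ) → (BlockIdx m → ℝ)}
    (hμ : Measurable μ) (hint : Integrable (decisionForm x Q S R μ) P) (b : BlockIdx m) :
    MemLp (fun ω ↦ μ (x ω).ofLp b) 2 P := by
  obtain ⟨C, -, hC⟩ := exists_sq_le_quadForm hQ hR
  have hG := hasGaussianLaw_coords hx
  have hL := fun a ↦ (hG.eval a).memLp_two
  have hmeas : AEStronglyMeasurable (fun ω ↦ μ (x ω).ofLp b) P :=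
    (((measurable_pi_apply b).comp hμ).comp_aemeasurable hG.aemeasurable).aestronglyMeasurable
  rw [memLp_two_iff_integrable_sq hmeas]
  have hQint : Integrable (fun ω ↦ (x ω).ofLp ⬝ᵥ (Q *ᵥ (x ω).ofLp)) P := by
    simp only [dotProduct_mulVec_eq_sum]
    exact integrable_sum_mul hL hL Q
  refine ((hint.add hQint).const_mul C).mono' (hmeas.pow 2) (.of_forall fun ω ↦ ?_)
  rw [Real.norm_eq_abs, abs_of_nonneg (sq_nonneg _)]
  exact hC _ _ b

/-- For one Gaussian state, every square integrable decentralized decision is matched by a linear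
one that is at least as good for all forms that are convex in the decision simultaneously: its
blocks are the regressions of the blocks of the decision on the blocks of the state. -/
lemma exists_linear_dominating (hx : HasLaw x (multivariateGaussian 0 X) P)
    {μ : (BlockIdx p → ℝ) → (BlockIdx m → ℝ)} (hμ : IsDecentralized μ)
    (hμL : ∀ b, MemLp (fun ω ↦ μ (x ω).ofLp b) 2 P) :
    ∃ K ∈ blockDiagonalGains p m, ∀ (Q : Matrix (BlockIdx p) (BlockIdx p) ℝ)
      (S : Matrix (BlockIdx p) (BlockIdx m) ℝ) (R : Matrix (BlockIdx m) (BlockIdx m) ℝ),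
      R.PosSemidef → ∫ ω, quadForm Q S R (x ω).ofLp (K *ᵥ (x ω).ofLp) ∂P
        ≤ ∫ ω, decisionForm x Q S R μ ω ∂P := by
  have hG := hasGaussianLaw_coords hx
  have hL := fun a ↦ (hG.eval a).memLp_two
  obtain ⟨μb, hμb, hμeq⟩ := hμ
  choose c hc using fun (i : Fin N) (k : Fin (m i)) ↦
    exists_linear_regression (fun l : Fin (p i) ↦ hL ⟨i, l⟩) (hμL ⟨i, k⟩)
  let Kb : (i : Fin N) → Matrix (Fin (m i)) (Fin (p i)) ℝ := fun i k l ↦ c i k l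
  let e : BlockIdx m → Ω → ℝ := fun b ω ↦
    μ (x ω).ofLp b - (Matrix.blockDiagonal' Kb *ᵥ (x ω).ofLp) b
  -- The residual is a function of the same block of the state as the decision.
  let g : (i : Fin N) → Fin (m i) → (Fin (p i) → ℝ) → ℝ := fun i k y ↦
    μb i y k - ∑ l, c i k l * y l
  have hg : ∀ i k, Measurable (g i k) := fun i k ↦
    ((measurable_pi_apply k).comp (hμb i)).sub (by fun_prop)
  have heg : ∀ i k, e ⟨i, k⟩ = fun ω ↦ g i k fun l ↦ x ω ⟨i, l⟩ := fun i k ↦ by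
    funext ω
    simp only [e, g, hμeq, blockDiagonal'_mulVec]
    rfl
  have heL : ∀ b, MemLp (e b) 2 P := fun b ↦
    (hμL b).sub (memLp_finsetSum _ fun a _ ↦ (hL a).const_mul _)
  have horth : ∀ a b, ∫ ω, x ω a * e b ω ∂P = 0 := by
    rintro a ⟨i, k⟩
    rw [heg]
    refine integral_mul_eq_zero_of_hasGaussianLaw hG (integral_coord hx)
      (fun l : Fin (p i) ↦ ⟨i, l⟩) (hg i k) ?_ (fun l ↦ ?_) a
    · rw [← heg]
      exact heL ⟨i, k⟩
    · simpa only [g, hμeq] using hc i k l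
  refine ⟨Matrix.blockDiagonal' Kb, ⟨Kb, rfl⟩, fun Q S R hR ↦ ?_⟩
  refine (integral_quadForm_linear_le hL heL horth Q S hR (Matrix.blockDiagonal' Kb)).trans_eq ?_
  refine integral_congr_ae (.of_forall fun ω ↦ ?_)
  have : (Matrix.blockDiagonal' Kb *ᵥ (x ω).ofLp) + (fun b ↦ e b ω) = μ (x ω).ofLp := by
    ext b
    simp [e]
  simp only [decisionForm, this]

end Domination

/-! ### Optimality of a linear decision -/

theorem mainTheorem1 {N M : ℕ} {p m : Fin N → ℕ}
    (X : Matrix (BlockIdx p) (BlockIdx p) ℝ) (hX : X.PosSemidef)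
    (Q : Fin (M + 1) → Matrix (BlockIdx p) (BlockIdx p) ℝ)
    (S : Fin (M + 1) → Matrix (BlockIdx p) (BlockIdx m) ℝ)
    (R : Fin (M + 1) → Matrix (BlockIdx m) (BlockIdx m) ℝ)
    (γ : Fin M → ℝ)
    (hQ₀ : (Matrix.fromBlocks (Q 0) (S 0) (S 0)ᵀ (R 0)).PosSemidef)
    (hR₀ : (R 0).PosDef)
    (hQ : ∀ j : Fin M,
      (Matrix.fromBlocks (Q j.succ) (S j.succ) (S j.succ)ᵀ (R j.succ)).IsSymm)
    (hR : ∀ j : Fin M, (R j.succ).PosSemidef) :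
    ∃ K ∈ blockDiagonalGains p m,
      ∀ {Ω : Type*} [MeasurableSpace Ω] (P : Measure Ω) [IsProbabilityMeasure P]
        (x : Ω → EuclideanSpace ℝ (BlockIdx p)),
        HasLaw x (multivariateGaussian 0 X) P →
        (∃ μ : (BlockIdx p → ℝ) → (BlockIdx m → ℝ), IsFeasible P x Q S R γ μ) →
        IsOptimal P x Q S R γ (fun y => K *ᵥ y) := by
  obtain ⟨B, hB⟩ := hX.exists_mul_transpose_eq
  let L : ((i : Fin N) → Matrix (Fin (m i)) (Fin (p i)) ℝ) →ₗ[ℝ]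
      Matrix (BlockIdx m) (BlockIdx p) ℝ :=
    { toFun := fun Kb ↦ Matrix.blockDiagonal' Kb * B
      map_add' := fun _ _ ↦ by rw [blockDiagonal'_add, Matrix.add_mul]
      map_smul' := fun c _ ↦ by rw [blockDiagonal'_smul, Matrix.smul_mul]; rfl }
  have hLmem : ∀ K ∈ blockDiagonalGains p m, K * B ∈ LinearMap.range L := by
    rintro _ ⟨Kb, rfl⟩
    exact ⟨Kb, rfl⟩
  by_cases hne : ∃ Y ∈ LinearMap.range L,
      ∀ j : Fin M, columnCost (Q j.succ) (S j.succ) (R j.succ) B Y ≤ γ j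
  · obtain ⟨_, ⟨Kb, rfl⟩, hKγ, hKmin⟩ := exists_minimizer_columnCost γ hQ₀ hR₀ B _ hne
    refine ⟨Matrix.blockDiagonal' Kb, ⟨Kb, rfl⟩, fun {Ω} _ P _ x hx _ ↦ ⟨⟨?_, ?_, ?_⟩, ?_⟩⟩
    · exact isDecentralized_of_mem_blockDiagonalGains ⟨Kb, rfl⟩
    · exact fun j ↦ integrable_quadForm_linear hx _ _ _ _
    · exact fun j ↦ (integral_quadForm_linear hX hx hB _ _ _ _).trans_le (hKγ j)
    · intro ν hν
      obtain ⟨K, hK, hdom⟩ := exists_linear_dominating hx hν.decentralized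
        (memLp_two_of_integrable_decisionForm hQ₀ hR₀ hx hν.decentralized.measurable
          (hν.integrable 0))
      simp only [integral_quadForm_linear hX hx hB] at hdom
      calc ∫ ω, decisionForm x (Q 0) (S 0) (R 0) (fun y ↦ Matrix.blockDiagonal' Kb *ᵥ y) ω ∂P
          = columnCost (Q 0) (S 0) (R 0) B (L Kb) := integral_quadForm_linear hX hx hB _ _ _ _
        _ ≤ columnCost (Q 0) (S 0) (R 0) B (K * B) :=
          hKmin _ (hLmem K hK) fun j ↦ (hdom _ _ _ (hR j)).trans (hν.constraint j)
        _ ≤ _ := hdom _ _ _ hR₀.posSemidef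
  · -- No linear decision satisfies the constraints, so by domination no decision is feasible.
    refine ⟨Matrix.blockDiagonal' 0, ⟨0, rfl⟩, fun {Ω} _ P _ x hx ⟨ν, hν⟩ ↦ (hne ?_).elim⟩
    obtain ⟨K, hK, hdom⟩ := exists_linear_dominating hx hν.decentralized
      (memLp_two_of_integrable_decisionForm hQ₀ hR₀ hx hν.decentralized.measurable
        (hν.integrable 0))
    simp only [integral_quadForm_linear hX hx hB] at hdom
    exact ⟨K * B, hLmem K hK, fun j ↦ (hdom _ _ _ (hR j)).trans (hν.constraint j)⟩
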